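/- Let $\sigma>0$, let $(X,Y,Z)\sim \mathrm P$ be a random vector in $\mathbb R^{d_X}\times\mathbb R^{d_Y}\times\mathbb R^{d_Z}$, $d=d_X+d_Y+d_Z$, and let $X'$ be drawn, given $(X,Y,Z)$, from the conditional distribution $\mathrm P_{X\mid Z}$ (so $X'\mid Z$ has the law of $X\mid Z$, and $X'$ is conditionally independent of $(X,Y)$ given $Z$). Let $\varphi_1,\varphi_2$ be the characteristic functions of $V=(X,Y,Z)$ and $V'=(X',Y,Z)$, and put $$\zeta_\sigma(\mathrm P)=\int_{\mathbb R^d}|\varphi_1(s)-\varphi_2(s)|^2\,(2\pi\sigma^2)^{-d/2}e^{-\|s\|^2/(2\sigma^2)}\,ds .$$ Let $(X_i,X_i',Y_i,Z_i)$, $i\ge 1$, be i.i.d. copies of $(X,X',Y,Z)$, i.e. $(X_i,Y_i,Z_i)$ is an i.i.d. sample from $\mathrm P$ and $X_i'\sim \mathrm P_{X\mid Z_i}$. With $K(v,w)=\exp\{-\tfrac{\sigma^2}{2}\|v-w\|^2\}$, $V_i=(X_i,Y_i,Z_i)$ and $V_i'=(X_i',Y_i,Z_i)$, let $$\hat\zeta_{n,\sigma}=\binom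 n2^{-1}\sum_{1\le i<j\le n}\Big\{K(V_i,V_j)+K(V_i',V_j')-K(V_i,V_j')-K(V_i',V_j)\Big\}.$$ Let $g_1(x,x',y,z)=\mathbb E\{K(v,V)+K(v',V')-K(v,V')-K(v',V)\}$, where $v=(x,y,z)$ and $v'=(x',y,z)$, and let $\sigma_1^2=\operatorname{Var}\big(g_1(X,X',Y,Z)\big)$. Then under $H_1$, that is, if $X$ and $Y$ are not conditionally independent given $Z$, one has $\sigma_1^2>0$ and, as $n\to\infty$, $$\sqrt n\,\big(\hat\zeta_{n,\sigma}-\zeta_\sigma(\mathrm P)\big)\ \xrightarrow{\ d\ }\ \mathcal N(0,4\sigma_1^2).$$ -/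

import Mathlib

open MeasureTheory ProbabilityTheory Filter
open scoped Topology

noncomputable section

namespace CIVariant

/-- The Euclidean space `ℝ^d`. -/
abbrev E (d : ℕ) : Type := EuclideanSpace ℝ (Fin d)

/-- The Euclidean space `ℝ^(dx + dy + dz)`, with coordinates indexed by the disjoint union of the
three index sets; it carries the Euclidean norm and Lebesgue measure. -/
abbrev Joint (dx dy dz : ℕ) : Type := EuclideanSpace ℝ (Fin dx ⊕ Fin dy ⊕ Fin dz)

/-- The vector of `ℝ^(dx + dy + dz)` obtained by concatenating `x`, `y` and `z`. -/
def stack {dx dy dz : ℕ} (x : E dx) (y : E dy) (z : E dz) : Joint dx dy dz :=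
  WithLp.toLp 2 (Sum.elim x (Sum.elim y z))

/-- The regular conditional distribution `P_{X|Z}`, where `(X, Y, Z) ∼ P`. -/
def condLawXZ {dx dy dz : ℕ} (P : Measure (E dx × E dy × E dz)) [IsProbabilityMeasure P] :
    Kernel (E dz) (E dx) :=
  condDistrib (fun v : E dx × E dy × E dz ↦ v.1) (fun v : E dx × E dy × E dz ↦ v.2.2) P

/-- The law of `(X, X', Y, Z)` where `(X, Y, Z) ∼ P` and, given `(X, Y, Z)`, the vector `X'` is
drawn from `P_{X|Z}` (so `X'` is conditionally independent of `(X, Y)` given `Z`). -/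
def augmentedLaw {dx dy dz : ℕ} (P : Measure (E dx × E dy × E dz)) [IsProbabilityMeasure P] :
    Measure (E dx × E dx × E dy × E dz) :=
  (P ⊗ₘ ((condLawXZ P).comap (fun v : E dx × E dy × E dz ↦ v.2.2) (by fun_prop))).map
    (fun p ↦ (p.1.1, p.2, p.1.2.1, p.1.2.2))

/-- The vector `V = (X, Y, Z)` read off from the augmented observation `(X, X', Y, Z)`. -/
def orig {dx dy dz : ℕ} (w : E dx × E dx × E dy × E dz) : Joint dx dy dz :=
  stack w.1 w.2.2.1 w.2.2.2

/-- The conditionally independent variant `V' = (X', Y, Z)` read off from `(X, X', Y, Z)`. -/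
def variant {dx dy dz : ℕ} (w : E dx × E dx × E dy × E dz) : Joint dx dy dz :=
  stack w.2.1 w.2.2.1 w.2.2.2

/-- The characteristic function of `V = (X, Y, Z) ∼ P`. -/
def phi₁ {dx dy dz : ℕ} (P : Measure (E dx × E dy × E dz)) (s : Joint dx dy dz) : ℂ :=
  charFun (P.map (fun v ↦ stack v.1 v.2.1 v.2.2)) s

/-- The characteristic function of the conditionally independent variant `V' = (X', Y, Z)`. -/
def phi₂ {dx dy dz : ℕ} (P : Measure (E dx × E dy × E dz)) [IsProbabilityMeasure P]
    (s : Joint dx dy dz) : ℂ :=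
  charFun ((augmentedLaw P).map variant) s

/-- The measure of conditional dependence `ζ_W(P) = ∫ |φ₁(s) - φ₂(s)|² W(s) ds`. -/
def zetaW {dx dy dz : ℕ} (W : Joint dx dy dz → ℝ) (P : Measure (E dx × E dy × E dz))
    [IsProbabilityMeasure P] : ℝ :=
  ∫ s, ‖phi₁ P s - phi₂ P s‖ ^ 2 * W s

/-- The density of the normal distribution `N(0, σ² I_d)` on `ℝ^d`, `d = dx + dy + dz`. -/
def gaussianDensity {dx dy dz : ℕ} (σ : ℝ) (s : Joint dx dy dz) : ℝ :=
  (2 * Real.pi * σ ^ 2) ^ (-((dx + dy + dz : ℕ) : ℝ) / 2) * Real.exp (-‖s‖ ^ 2 / (2 * σ ^ 2))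

/-- `ζ_σ(P)`, the measure of conditional dependence with Gaussian weight. -/
def zeta {dx dy dz : ℕ} (σ : ℝ) (P : Measure (E dx × E dy × E dz))
    [IsProbabilityMeasure P] : ℝ :=
  zetaW (gaussianDensity σ) P

/-- The Gaussian kernel `K(v, w) = exp(-σ² ‖v - w‖² / 2)`. -/
def gaussKernel {dx dy dz : ℕ} (σ : ℝ) (v w : Joint dx dy dz) : ℝ :=
  Real.exp (-(σ ^ 2 / 2) * ‖v - w‖ ^ 2)

/-- The symmetric core function
`g(w₁, w₂) = K(V₁, V₂) + K(V₁', V₂') - K(V₁, V₂') - K(V₁', V₂)`. -/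
def core {dx dy dz : ℕ} (σ : ℝ) (w₁ w₂ : E dx × E dx × E dy × E dz) : ℝ :=
  gaussKernel σ (orig w₁) (orig w₂) + gaussKernel σ (variant w₁) (variant w₂)
    - gaussKernel σ (orig w₁) (variant w₂) - gaussKernel σ (variant w₁) (orig w₂)

/-- The estimator of `ζ_σ(P)`: the U-statistic with core function `g` based on the augmented
observations `w 0, …, w (n - 1)`. -/
def zetaHat {dx dy dz : ℕ} (σ : ℝ) (n : ℕ) (w : ℕ → E dx × E dx × E dy × E dz) : ℝ :=
  ((n.choose 2 : ℕ) : ℝ)⁻¹ *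
    ∑ i ∈ Finset.range n, ∑ j ∈ Finset.Ico (i + 1) n, core σ (w i) (w j)

/-- The first-order projection `g₁(w) = E[g(w, (X, X', Y, Z))]`. -/
def proj₁ {dx dy dz : ℕ} (σ : ℝ) (P : Measure (E dx × E dy × E dz)) [IsProbabilityMeasure P]
    (w : E dx × E dx × E dy × E dz) : ℝ :=
  ∫ w', core σ w w' ∂(augmentedLaw P)

/-- `σ₁² = Var(g₁(X, X', Y, Z))`. -/
def sigmaOneSq {dx dy dz : ℕ} (σ : ℝ) (P : Measure (E dx × E dy × E dz))
    [IsProbabilityMeasure P] : ℝ :=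
  variance (proj₁ σ P) (augmentedLaw P)

/-- The null hypothesis: `X` and `Y` are conditionally independent given `Z`,
where `(X, Y, Z) ∼ P`. -/
def NullHypothesis {dx dy dz : ℕ} (P : Measure (E dx × E dy × E dz))
    [IsProbabilityMeasure P] : Prop :=
  CondIndepFun (MeasurableSpace.comap (fun v : E dx × E dy × E dz ↦ v.2.2) inferInstance)
    (Measurable.comap_le (by fun_prop))
    (fun v : E dx × E dy × E dz ↦ v.1) (fun v : E dx × E dy × E dz ↦ v.2.1) P

end CIVariant

end

/-! Limit law. `core` is bounded and symmetric, so the classical theory of U-statistics applies. The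
Hoeffding decomposition (`stat_sub_eq`) splits the centred statistic into an average of i.i.d. terms
`2 * g₁`, which obeys the central limit theorem with variance `4σ₁²`, and a degenerate remainder.
Distinct pairs contribute orthogonal terms to the remainder, so its second moment is of order `n⁻²`
and it vanishes in probability even after multiplication by `√n`.

Centring. The Gaussian kernel is the Fourier transform of the Gaussian weight. Hence `core σ w₁ w₂`
is the weighted inner product of the functions `s ↦ charDiff s wᵢ`, whose mean is `φ₁ - φ₂`; Fubini
gives expectation `ζ_σ(P)` (`integral_integral_core`).

Positivity. If `σ₁² = 0`, then `g₁` is almost surely its mean `ζ_σ(P)`. Now `g₁ = h(V) - h(V')` for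
a continuous `h`, and `X` almost surely lies in the support of `P_{X|Z}`, from which `X'` is drawn.
So `x'` may be moved to `X`, where `g₁` vanishes, and `ζ_σ(P) = 0` (`eq_zero_of_proj₁_ae_eq_const`).
Then `φ₁ = φ₂`, the vectors `V` and `V'` have the same law, and the null hypothesis holds
(`zeta_ne_zero`). -/

namespace UStatistic

/-! ### Sums over pairs of indices -/

section Sums

variable {M : Type*} [AddCommMonoid M]

lemma sum_range_sum_Ico_succ (f : ℕ → ℕ → M) (n : ℕ) :
    ∑ i ∈ Finset.range (n + 1), ∑ j ∈ Finset.Ico (i + 1) (n + 1), f i j =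
      ∑ i ∈ Finset.range n, ∑ j ∈ Finset.Ico (i + 1) n, f i j + ∑ i ∈ Finset.range n, f i n := by
  rw [Finset.sum_range_succ, ← Finset.sum_add_distrib]
  simp only [Finset.Ico_self, Finset.sum_empty, add_zero]
  refine Finset.sum_congr rfl fun i hi ↦ ?_
  rw [Finset.sum_Ico_succ_top (by simpa using hi)]

lemma sum_range_sum_Ico_add (a : ℕ → ℝ) (n : ℕ) :
    ∑ i ∈ Finset.range n, ∑ j ∈ Finset.Ico (i + 1) n, (a i + a j) =
      ((n : ℝ) - 1) * ∑ i ∈ Finset.range n, a i := by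
  induction n with
  | zero => simp
  | succ n ih =>
    rw [sum_range_sum_Ico_succ, ih, Finset.sum_add_distrib, Finset.sum_range_succ]
    simp
    ring

lemma sum_range_sum_Ico_const (c : ℝ) (n : ℕ) :
    ∑ i ∈ Finset.range n, ∑ _j ∈ Finset.Ico (i + 1) n, c = (n.choose 2 : ℝ) * c := by
  induction n with
  | zero => simp
  | succ n ih =>
    rw [sum_range_sum_Ico_succ, ih, Nat.choose_succ_succ' n 1]
    simp
    ring

/-- The pairs `i < j < n`. -/
def pairs (n : ℕ) : Finset (Σ _ : ℕ, ℕ) :=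
  (Finset.range n).sigma fun i ↦ Finset.Ico (i + 1) n

lemma lt_of_mem_pairs {n : ℕ} {p : Σ _ : ℕ, ℕ} (hp : p ∈ pairs n) : p.1 < p.2 := by
  simp only [pairs, Finset.mem_sigma, Finset.mem_Ico] at hp
  omega

lemma card_pairs (n : ℕ) : ((pairs n).card : ℝ) = n.choose 2 := by
  have := sum_range_sum_Ico_const 1 n
  rw [Finset.sum_sigma'] at this
  simpa [pairs] using this

end Sums

/-! ### Orthogonality, Hoeffding decomposition and the limit theorem -/

variable {S Ω : Type*} [MeasurableSpace S] [MeasurableSpace Ω] {μ : Measure Ω}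
  [IsProbabilityMeasure μ] {ν : Measure S} [IsProbabilityMeasure ν] {W : ℕ → Ω → S}
  {ψ h : S → S → ℝ} {C : ℝ}

/-- Only one argument involves `W j`, which is independent of the triple `(W i, W k, W l)`;
integrating it out first gives zero by degeneracy. The indices `i`, `k`, `l` may coincide. -/
lemma integral_mul_eq_zero_of_ne (hindep : iIndepFun W μ) (hlaw : ∀ i, HasLaw (W i) ν μ)
    (hψ : Measurable (Function.uncurry ψ)) (hC : ∀ x y, |ψ x y| ≤ C)
    (hdeg : ∀ x, ∫ y, ψ x y ∂ν = 0) {i j k l : ℕ} (hi : i ≠ j) (hk : k ≠ j) (hl : l ≠ j) :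
    ∫ ω, ψ (W i ω) (W j ω) * ψ (W k ω) (W l ω) ∂μ = 0 := by
  have hW i : AEMeasurable (W i) μ := (hlaw i).aemeasurable
  have hAB : IndepFun (fun ω ↦ (W i ω, W k ω, W l ω)) (W j) μ := by
    have := hindep.indepFun_finset₀ {i, k, l} {j} (by simp [hi.symm, hk.symm, hl.symm]) hW
    exact this.comp
      (φ := fun f : (({i, k, l} : Finset ℕ) → S) ↦
        (f ⟨i, by simp⟩, f ⟨k, by simp⟩, f ⟨l, by simp⟩))
      (ψ := fun f : (({j} : Finset ℕ) → S) ↦ f ⟨j, by simp⟩) (by fun_prop) (by fun_prop)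
  have hA : AEMeasurable (fun ω ↦ (W i ω, W k ω, W l ω)) μ := by fun_prop
  have hmap := (indepFun_iff_map_prod_eq_prod_map_map hA (hW j)).1 hAB
  rw [(hlaw j).map_eq] at hmap
  have := Measure.isProbabilityMeasure_map hA
  have hmeas : Measurable fun p : (S × S × S) × S ↦ ψ p.1.1 p.2 * ψ p.1.2.1 p.1.2.2 := by
    refine Measurable.mul ?_ ?_
    · exact hψ.comp (f := fun p : (S × S × S) × S ↦ (p.1.1, p.2)) (by fun_prop)
    · exact hψ.comp (f := fun p : (S × S × S) × S ↦ (p.1.2.1, p.1.2.2)) (by fun_prop)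
  have hint : Integrable (fun p : (S × S × S) × S ↦ ψ p.1.1 p.2 * ψ p.1.2.1 p.1.2.2)
      ((μ.map fun ω ↦ (W i ω, W k ω, W l ω)).prod ν) := by
    refine Integrable.of_bound hmeas.aestronglyMeasurable (C * C) (ae_of_all _ fun p ↦ ?_)
    rw [Real.norm_eq_abs, abs_mul]
    exact mul_le_mul (hC _ _) (hC _ _) (abs_nonneg _) ((abs_nonneg _).trans (hC p.2 p.2))
  calc ∫ ω, ψ (W i ω) (W j ω) * ψ (W k ω) (W l ω) ∂μ
      = ∫ p, ψ p.1.1 p.2 * ψ p.1.2.1 p.1.2.2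
          ∂(μ.map fun ω ↦ ((W i ω, W k ω, W l ω), W j ω)) := by
        rw [integral_map (by fun_prop) hmeas.aestronglyMeasurable]
    _ = 0 := by
        rw [hmap, integral_prod _ hint]
        simp [integral_mul_const, hdeg]

/-- Pairs of distinct indices give uncorrelated values of a degenerate kernel. -/
lemma integral_mul_eq_zero (hindep : iIndepFun W μ) (hlaw : ∀ i, HasLaw (W i) ν μ)
    (hψ : Measurable (Function.uncurry ψ)) (hC : ∀ x y, |ψ x y| ≤ C)
    (hsymm : ∀ x y, ψ x y = ψ y x) (hdeg : ∀ x, ∫ y, ψ x y ∂ν = 0)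
    {p q : Σ _ : ℕ, ℕ} (hp : p.1 < p.2) (hq : q.1 < q.2) (hpq : p ≠ q) :
    ∫ ω, ψ (W p.1 ω) (W p.2 ω) * ψ (W q.1 ω) (W q.2 ω) ∂μ = 0 := by
  obtain ⟨i, j⟩ := p
  obtain ⟨k, l⟩ := q
  simp only at hp hq ⊢
  -- Two different ordered pairs differ in some index: either `j` is missing from `q`, or `j`
  -- belongs to `q` and then `i` is missing. The missing index is the one integrated out, after a
  -- swap by symmetry in the second case.
  by_cases hj : k ≠ j ∧ l ≠ j
  · exact integral_mul_eq_zero_of_ne hindep hlaw hψ hC hdeg hp.ne hj.1 hj.2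
  · have hi : k ≠ i ∧ l ≠ i := by
      refine ⟨?_, ?_⟩
      · rintro rfl
        apply hpq
        have : l = j := by omega
        rw [this]
      · rintro rfl
        omega
    simp_rw [hsymm (W i _) (W j _)]
    exact integral_mul_eq_zero_of_ne hindep hlaw hψ hC hdeg hp.ne' hi.1 hi.2

omit [IsProbabilityMeasure μ] [IsProbabilityMeasure ν] in
lemma aemeasurable_kernel (hlaw : ∀ i, HasLaw (W i) ν μ) (hψ : Measurable (Function.uncurry ψ))
    (i j : ℕ) : AEMeasurable (fun ω ↦ ψ (W i ω) (W j ω)) μ :=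
  hψ.comp_aemeasurable ((hlaw i).aemeasurable.prodMk (hlaw j).aemeasurable)

/-- After expanding the square only the diagonal terms survive, each at most `C ^ 2`. The bound is
therefore of order `n²` rather than `n⁴`. -/
lemma integral_sq_sum_le (hindep : iIndepFun W μ) (hlaw : ∀ i, HasLaw (W i) ν μ)
    (hψ : Measurable (Function.uncurry ψ)) (hC : ∀ x y, |ψ x y| ≤ C)
    (hsymm : ∀ x y, ψ x y = ψ y x) (hdeg : ∀ x, ∫ y, ψ x y ∂ν = 0) (n : ℕ) :
    ∫ ω, (∑ p ∈ pairs n, ψ (W p.1 ω) (W p.2 ω)) ^ 2 ∂μ ≤ (n.choose 2 : ℝ) * C ^ 2 := by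
  have hmul (x y x' y' : S) : |ψ x y * ψ x' y'| ≤ C ^ 2 := by
    rw [abs_mul, sq]
    exact mul_le_mul (hC _ _) (hC _ _) (abs_nonneg _) ((abs_nonneg _).trans (hC x y))
  have hint (p q : Σ _ : ℕ, ℕ) :
      Integrable (fun ω ↦ ψ (W p.1 ω) (W p.2 ω) * ψ (W q.1 ω) (W q.2 ω)) μ :=
    Integrable.of_bound ((aemeasurable_kernel hlaw hψ _ _).mul
      (aemeasurable_kernel hlaw hψ _ _)).aestronglyMeasurable (C ^ 2)
      (ae_of_all _ fun ω ↦ hmul _ _ _ _)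
  simp_rw [sq, Finset.sum_mul_sum]
  rw [integral_finsetSum _ fun p _ ↦ integrable_finsetSum _ fun q _ ↦ hint p q]
  calc ∑ p ∈ pairs n, ∫ ω, ∑ q ∈ pairs n, ψ (W p.1 ω) (W p.2 ω) * ψ (W q.1 ω) (W q.2 ω) ∂μ
      ≤ ∑ p ∈ pairs n, C ^ 2 := by
        refine Finset.sum_le_sum fun p hp ↦ ?_
        rw [integral_finsetSum _ fun q _ ↦ hint p q, Finset.sum_eq_single_of_mem p hp fun q hq hqp ↦
          integral_mul_eq_zero hindep hlaw hψ hC hsymm hdeg (lt_of_mem_pairs hp)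
            (lt_of_mem_pairs hq) hqp.symm]
        calc _ ≤ ∫ _, C ^ 2 ∂μ := integral_mono (hint p p) (by simp) fun ω ↦
              (le_abs_self _).trans (hmul _ _ _ _)
          _ = C ^ 2 := by simp
    _ = (n.choose 2 : ℝ) * (C * C) := by simp [card_pairs, sq]

/-- The U-statistic of order two with kernel `h`. -/
noncomputable def stat (h : S → S → ℝ) (n : ℕ) (w : ℕ → S) : ℝ :=
  ((n.choose 2 : ℕ) : ℝ)⁻¹ * ∑ i ∈ Finset.range n, ∑ j ∈ Finset.Ico (i + 1) n, h (w i) (w j)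

/-- The degenerate part of the kernel `h` in its Hoeffding decomposition. -/
noncomputable def degenerate (ν : Measure S) (h : S → S → ℝ) (x y : S) : ℝ :=
  h x y - ∫ z, h x z ∂ν - ∫ z, h y z ∂ν + ∫ x, ∫ y, h x y ∂ν ∂ν

lemma measurable_proj (hh : Measurable (Function.uncurry h)) :
    Measurable fun x ↦ ∫ y, h x y ∂ν :=
  (hh.stronglyMeasurable.integral_prod_right (ν := ν)).measurable

lemma abs_integral_le (f : S → ℝ) (hf : ∀ x, |f x| ≤ C) : |∫ x, f x ∂ν| ≤ C := by
  simpa using norm_integral_le_of_norm_le_const (μ := ν) (f := f) (ae_of_all _ hf)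

lemma integrable_of_abs_le {f : S → ℝ} (hm : Measurable f) (hf : ∀ x, |f x| ≤ C) :
    Integrable f ν :=
  Integrable.of_bound hm.aestronglyMeasurable C (ae_of_all _ hf)

lemma measurable_degenerate (hh : Measurable (Function.uncurry h)) :
    Measurable (Function.uncurry (degenerate ν h)) :=
  have hg : Measurable fun x ↦ ∫ y, h x y ∂ν := measurable_proj hh
  ((hh.sub (hg.comp measurable_fst)).sub (hg.comp measurable_snd)).add_const _

lemma abs_degenerate_le (hC : ∀ x y, |h x y| ≤ C) (x y : S) : |degenerate ν h x y| ≤ 4 * C := by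
  have hgC x : |∫ y, h x y ∂ν| ≤ C := abs_integral_le _ (hC x)
  have h1 := abs_le.1 (hC x y)
  have h2 := abs_le.1 (hgC x)
  have h3 := abs_le.1 (hgC y)
  have h4 := abs_le.1 (abs_integral_le (ν := ν) _ hgC)
  unfold degenerate
  rw [abs_le]
  constructor <;> linarith [h1.1, h1.2, h2.1, h2.2, h3.1, h3.2, h4.1, h4.2]

omit [IsProbabilityMeasure ν] in
/-- Hoeffding decomposition of a U-statistic of order two. -/
lemma stat_sub_eq (h : S → S → ℝ) {n : ℕ} (hn : 2 ≤ n) (w : ℕ → S) :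
    stat h n w - ∫ x, ∫ y, h x y ∂ν ∂ν =
      (n : ℝ)⁻¹ * (∑ k ∈ Finset.range n, 2 * ∫ y, h (w k) y ∂ν
        - n * (2 * ∫ x, ∫ y, h x y ∂ν ∂ν))
      + (n.choose 2 : ℝ)⁻¹ * ∑ p ∈ pairs n, degenerate ν h (w p.1) (w p.2) := by
  have hn0 : (n : ℝ) ≠ 0 := by positivity
  have hn1 : (n : ℝ) - 1 ≠ 0 := by
    have : (2 : ℝ) ≤ n := by exact_mod_cast hn
    linarith
  -- Each index lies in `n - 1` of the pairs; against `n.choose 2 = n(n-1)/2` this yields the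
  -- coefficient `2/n` of the linear part.
  have hsum : ∑ p ∈ pairs n, degenerate ν h (w p.1) (w p.2) =
      ∑ i ∈ Finset.range n, ∑ j ∈ Finset.Ico (i + 1) n, h (w i) (w j)
      - ((n : ℝ) - 1) * ∑ i ∈ Finset.range n, ∫ y, h (w i) y ∂ν
      + (n.choose 2 : ℝ) * ∫ x, ∫ y, h x y ∂ν ∂ν := by
    rw [← sum_range_sum_Ico_add, ← sum_range_sum_Ico_const, ← Finset.sum_sub_distrib,
      ← Finset.sum_add_distrib, pairs, Finset.sum_sigma]
    refine Finset.sum_congr rfl fun i _ ↦ ?_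
    rw [← Finset.sum_sub_distrib, ← Finset.sum_add_distrib]
    refine Finset.sum_congr rfl fun j _ ↦ ?_
    simp only [degenerate]
    ring
  rw [hsum, stat, ← Finset.mul_sum, Nat.cast_choose_two]
  field_simp
  ring

/-- Second-moment bound for the degenerate part of the U-statistic. -/
lemma integral_sq_degenerate_le (hindep : iIndepFun W μ) (hlaw : ∀ i, HasLaw (W i) ν μ)
    (hh : Measurable (Function.uncurry h)) (hC : ∀ x y, |h x y| ≤ C)
    (hsymm : ∀ x y, h x y = h y x) (n : ℕ) :
    ∫ ω, (∑ p ∈ pairs n, degenerate ν h (W p.1 ω) (W p.2 ω)) ^ 2 ∂μ ≤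
      (n.choose 2 : ℝ) * (4 * C) ^ 2 := by
  have hg : Measurable fun x ↦ ∫ y, h x y ∂ν := measurable_proj hh
  have hgC x : |∫ y, h x y ∂ν| ≤ C := abs_integral_le _ (hC x)
  refine integral_sq_sum_le hindep hlaw (measurable_degenerate hh) (abs_degenerate_le hC) ?_ ?_ n
  · intro x y
    simp only [degenerate, hsymm x y]
    ring
  · intro x
    have i1 : Integrable (fun y ↦ h x y) ν :=
      integrable_of_abs_le (hh.comp measurable_prodMk_left) (hC x)
    have i2 : Integrable (fun y ↦ ∫ z, h y z ∂ν) ν := integrable_of_abs_le hg hgC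
    simp only [degenerate]
    have i3 : Integrable (fun y ↦ h x y - ∫ z, h x z ∂ν) ν := i1.sub (integrable_const _)
    have i4 : Integrable (fun y ↦ h x y - ∫ z, h x z ∂ν - ∫ z, h y z ∂ν) ν := i3.sub i2
    rw [integral_add i4 (integrable_const _), integral_sub i3 i2,
      integral_sub i1 (integrable_const _)]
    simp

/-- Central limit theorem for U-statistics of order two with a bounded symmetric kernel. -/
theorem tendstoInDistribution_stat (hindep : iIndepFun W μ) (hlaw : ∀ i, HasLaw (W i) ν μ)
    (hh : Measurable (Function.uncurry h)) (hC : ∀ x y, |h x y| ≤ C)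
    (hsymm : ∀ x y, h x y = h y x) :
    TendstoInDistribution
      (fun (n : ℕ) ω ↦ √(n : ℝ) * (stat h n (fun i ↦ W i ω) - ∫ x, ∫ y, h x y ∂ν ∂ν))
      atTop (id : ℝ → ℝ) (fun _ ↦ μ)
      (gaussianReal 0 (4 * variance (fun x ↦ ∫ y, h x y ∂ν) ν).toNNReal) := by
  set θ := ∫ x, ∫ y, h x y ∂ν ∂ν with hθdef
  have hg : Measurable fun x ↦ ∫ y, h x y ∂ν := measurable_proj hh
  have hgC x : |∫ y, h x y ∂ν| ≤ C := abs_integral_le _ (hC x)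
  -- The factor 2 records the two arguments of the kernel and produces the 4 in the limiting
  -- variance.
  let X : ℕ → Ω → ℝ := fun k ω ↦ 2 * ∫ y, h (W k ω) y ∂ν
  have hG : Measurable fun x ↦ 2 * ∫ y, h x y ∂ν := hg.const_mul 2
  have hmean : μ[X 0] = 2 * θ := by
    have := (hlaw 0).integral_comp (f := fun x ↦ 2 * ∫ y, h x y ∂ν) hG.aestronglyMeasurable
    rw [show X 0 = (fun x ↦ 2 * ∫ y, h x y ∂ν) ∘ W 0 from rfl, this, integral_const_mul]
  have hvar : variance (X 0) μ = 4 * variance (fun x ↦ ∫ y, h x y ∂ν) ν := by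
    have h1 : variance (fun x ↦ ∫ y, h x y ∂ν) ν =
        variance ((fun x ↦ ∫ y, h x y ∂ν) ∘ W 0) μ := by
      rw [← variance_map hg.aemeasurable (hlaw 0).aemeasurable, (hlaw 0).map_eq]
    rw [h1, show X 0 = fun ω ↦ 2 * ((fun x ↦ ∫ y, h x y ∂ν) ∘ W 0) ω from rfl,
      variance_const_mul]
    norm_num
  have hXm k : AEMeasurable (X k) μ := hG.comp_aemeasurable (hlaw k).aemeasurable
  have hclt := tendstoInDistribution_inv_sqrt_mul_sum_sub (P := μ) (X := X)
    (P' := gaussianReal 0 (variance (X 0) μ).toNNReal) (Y := id) HasLaw.id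
    (MemLp.of_bound (hXm 0).aestronglyMeasurable (2 * C) (ae_of_all _ fun ω ↦ by
      simp only [X, Real.norm_eq_abs, abs_mul, abs_two]
      gcongr
      exact hgC _))
    (hindep.comp (fun _ x ↦ 2 * ∫ y, h x y ∂ν) fun _ ↦ hG)
    (fun i ↦ IdentDistrib.comp (u := fun x ↦ 2 * ∫ y, h x y ∂ν)
      ⟨(hlaw i).aemeasurable, (hlaw 0).aemeasurable, by rw [(hlaw i).map_eq, (hlaw 0).map_eq]⟩ hG)
  rw [hmean, hvar] at hclt
  have hstat n : AEMeasurable (fun ω ↦ stat h n (fun i ↦ W i ω)) μ := by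
    refine AEMeasurable.const_mul ?_ _
    exact Finset.aemeasurable_fun_sum _ fun i _ ↦ Finset.aemeasurable_fun_sum _ fun j _ ↦
      aemeasurable_kernel hlaw hh i j
  have hDm n : AEMeasurable (fun ω ↦ ∑ p ∈ pairs n, degenerate ν h (W p.1 ω) (W p.2 ω)) μ :=
    Finset.aemeasurable_fun_sum _ fun p _ ↦ aemeasurable_kernel hlaw (measurable_degenerate hh) _ _
  -- Slutsky: it suffices that the difference from the linear part tends to zero in probability.
  refine tendstoInDistribution_of_tendstoInMeasure_sub _ _ hclt ?_
    (fun n ↦ ((hstat n).sub_const _).const_mul _)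
  rw [tendstoInMeasure_iff_measureReal_norm]
  intro ε hε
  -- Chebyshev's inequality for the degenerate part; the rate comes from `n / n.choose 2 = 2 / (n -
  -- 1)`.
  have hbound : ∀ᶠ n : ℕ in atTop, μ.real {ω | ε ≤ ‖((fun (n : ℕ) ω ↦ √(n : ℝ) *
      (stat h n (fun i ↦ W i ω) - θ)) - fun (n : ℕ) ω ↦ (√(n : ℝ))⁻¹ *
      (∑ k ∈ Finset.range n, X k ω - n * (2 * θ))) n ω - (0 : ℕ → Ω → ℝ) n ω‖} ≤
      (ε ^ 2)⁻¹ * (2 * (4 * C) ^ 2 / ((n : ℝ) - 1)) := by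
    filter_upwards [eventually_ge_atTop 2] with n hn
    have hn2 : (2 : ℝ) ≤ n := by exact_mod_cast hn
    have hn1 : (n : ℝ) - 1 ≠ 0 := by linarith
    have hdiff ω : ((fun (n : ℕ) ω ↦ √(n : ℝ) * (stat h n (fun i ↦ W i ω) - θ)) -
        fun (n : ℕ) ω ↦ (√(n : ℝ))⁻¹ * (∑ k ∈ Finset.range n, X k ω - n * (2 * θ))) n ω
          - (0 : ℕ → Ω → ℝ) n ω
        = √(n : ℝ) * (n.choose 2 : ℝ)⁻¹ *
          ∑ p ∈ pairs n, degenerate ν h (W p.1 ω) (W p.2 ω) := by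
      simp only [Pi.sub_apply, Pi.zero_apply, sub_zero]
      rw [hθdef, stat_sub_eq h hn, ← hθdef]
      have hs : √(n : ℝ) * (n : ℝ)⁻¹ = (√(n : ℝ))⁻¹ := by
        have : √(n : ℝ) * √(n : ℝ) = n := Real.mul_self_sqrt (by positivity)
        have h0 : √(n : ℝ) ≠ 0 := by positivity
        nth_rw 2 [← this]
        field_simp
      simp only [X]
      rw [mul_add, ← mul_assoc, hs]
      ring
    have hint : Integrable (fun ω ↦ (√(n : ℝ) * (n.choose 2 : ℝ)⁻¹ *
        ∑ p ∈ pairs n, degenerate ν h (W p.1 ω) (W p.2 ω)) ^ 2) μ := by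
      have hsumC ω : |∑ p ∈ pairs n, degenerate ν h (W p.1 ω) (W p.2 ω)| ≤
          ∑ p ∈ pairs n, 4 * C :=
        (Finset.abs_sum_le_sum_abs _ _).trans (Finset.sum_le_sum fun p _ ↦ abs_degenerate_le hC _ _)
      refine Integrable.of_bound (((hDm n).const_mul _).pow_const 2).aestronglyMeasurable
        ((|√(n : ℝ) * (n.choose 2 : ℝ)⁻¹| * ∑ p ∈ pairs n, 4 * C) ^ 2) (ae_of_all _ fun ω ↦ ?_)
      rw [norm_pow, Real.norm_eq_abs, abs_mul]
      have := hsumC ω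
      gcongr
    have hset : {ω | ε ≤ ‖((fun (n : ℕ) ω ↦ √(n : ℝ) *
        (stat h n (fun i ↦ W i ω) - θ)) - fun (n : ℕ) ω ↦ (√(n : ℝ))⁻¹ *
        (∑ k ∈ Finset.range n, X k ω - n * (2 * θ))) n ω - (0 : ℕ → Ω → ℝ) n ω‖} ⊆
        {ω | ε ^ 2 ≤ (√(n : ℝ) * (n.choose 2 : ℝ)⁻¹ *
          ∑ p ∈ pairs n, degenerate ν h (W p.1 ω) (W p.2 ω)) ^ 2} := by
      intro ω hω
      rw [Set.mem_ofPred_eq, hdiff ω] at hω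
      rw [Set.mem_ofPred_eq, ← sq_abs (_ * _)]
      gcongr
      exact hω
    refine (measureReal_mono hset).trans ?_
    rw [← div_eq_inv_mul, le_div_iff₀ (by positivity), mul_comm]
    refine (mul_meas_ge_le_integral_of_nonneg (ae_of_all _ fun ω ↦ sq_nonneg _) hint _).trans ?_
    simp_rw [mul_pow _ (∑ p ∈ pairs n, degenerate ν h (W p.1 _) (W p.2 _))]
    rw [integral_const_mul]
    calc _ ≤ (√(n : ℝ) * (n.choose 2 : ℝ)⁻¹) ^ 2 * ((n.choose 2 : ℝ) * (4 * C) ^ 2) := by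
          gcongr
          exact integral_sq_degenerate_le hindep hlaw hh hC hsymm n
      _ = 2 * (4 * C) ^ 2 / ((n : ℝ) - 1) := by
          rw [mul_pow, Real.sq_sqrt (by positivity), Nat.cast_choose_two]
          have : (n : ℝ) ≠ 0 := by positivity
          field_simp
  have hlim : Tendsto (fun n : ℕ ↦ (ε ^ 2)⁻¹ * (2 * (4 * C) ^ 2 / ((n : ℝ) - 1))) atTop (𝓝 0) := by
    rw [← mul_zero (ε ^ 2)⁻¹]
    refine Tendsto.const_mul _ (Tendsto.const_div_atTop ?_ _)
    exact tendsto_atTop_add_const_right _ _ tendsto_natCast_atTop_atTop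
  exact tendsto_of_tendsto_of_tendsto_of_le_of_le' tendsto_const_nhds hlim
    (Eventually.of_forall fun n ↦ measureReal_nonneg) hbound

end UStatistic

/-! ### Regularity of the Gaussian kernel and of the core function -/

namespace CIVariant

variable {dx dy dz : ℕ}

lemma continuous_stack :
    Continuous fun p : E dx × E dy × E dz ↦ stack p.1 p.2.1 p.2.2 := by
  unfold stack
  refine (PiLp.continuous_toLp 2 _).comp (continuous_pi fun i ↦ ?_)
  rcases i with i | i | i <;> simp only [Sum.elim_inl, Sum.elim_inr] <;> fun_prop

lemma continuous_orig : Continuous (orig : E dx × E dx × E dy × E dz → Joint dx dy dz) :=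
  continuous_stack.comp
    (f := fun w : E dx × E dx × E dy × E dz ↦ (w.1, w.2.2.1, w.2.2.2)) (by fun_prop)

lemma continuous_variant : Continuous (variant : E dx × E dx × E dy × E dz → Joint dx dy dz) :=
  continuous_stack.comp
    (f := fun w : E dx × E dx × E dy × E dz ↦ (w.2.1, w.2.2.1, w.2.2.2)) (by fun_prop)

lemma gaussKernel_comm (σ : ℝ) (v w : Joint dx dy dz) : gaussKernel σ v w = gaussKernel σ w v := by
  simp only [gaussKernel, norm_sub_rev]

lemma gaussKernel_pos (σ : ℝ) (v w : Joint dx dy dz) : 0 < gaussKernel σ v w :=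
  Real.exp_pos _

lemma gaussKernel_le_one (σ : ℝ) (v w : Joint dx dy dz) : gaussKernel σ v w ≤ 1 := by
  rw [gaussKernel, Real.exp_le_one_iff, neg_mul]
  exact neg_nonpos.2 (by positivity)

lemma core_comm (σ : ℝ) (w₁ w₂ : E dx × E dx × E dy × E dz) : core σ w₁ w₂ = core σ w₂ w₁ := by
  simp only [core, gaussKernel_comm σ (orig w₁), gaussKernel_comm σ (variant w₁)]
  ring

lemma abs_core_le (σ : ℝ) (w₁ w₂ : E dx × E dx × E dy × E dz) : |core σ w₁ w₂| ≤ 2 := by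
  have h v w := gaussKernel_pos σ (dx := dx) (dy := dy) (dz := dz) v w
  have h' v w := gaussKernel_le_one σ (dx := dx) (dy := dy) (dz := dz) v w
  rw [core, abs_le]
  constructor <;>
  linarith [h (orig w₁) (orig w₂), h (orig w₁) (variant w₂), h (variant w₁) (orig w₂),
    h (variant w₁) (variant w₂), h' (orig w₁) (orig w₂), h' (orig w₁) (variant w₂),
    h' (variant w₁) (orig w₂), h' (variant w₁) (variant w₂)]

lemma continuous_core (σ : ℝ) :
    Continuous (Function.uncurry
      (core σ : E dx × E dx × E dy × E dz → E dx × E dx × E dy × E dz → ℝ)) := by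
  have h1 := continuous_orig (dx := dx) (dy := dy) (dz := dz)
  have h2 := continuous_variant (dx := dx) (dy := dy) (dz := dz)
  unfold Function.uncurry core gaussKernel
  fun_prop

lemma measurable_core (σ : ℝ) :
    Measurable (Function.uncurry
      (core σ : E dx × E dx × E dy × E dz → E dx × E dx × E dy × E dz → ℝ)) :=
  (continuous_core σ).measurable

/-! ### The augmented law and its marginals -/

section Law

variable (P : Measure (E dx × E dy × E dz)) [IsProbabilityMeasure P]

instance : IsMarkovKernel (condLawXZ P) := by unfold condLawXZ; infer_instance

instance : IsProbabilityMeasure (augmentedLaw P) :=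
  Measure.isProbabilityMeasure_map (by fun_prop)

lemma augmentedLaw_map_forget :
    (augmentedLaw P).map (fun w ↦ (w.1, w.2.2.1, w.2.2.2)) = P := by
  rw [augmentedLaw, Measure.map_map (by fun_prop) (by fun_prop)]
  exact Measure.fst_compProd P _

lemma augmentedLaw_map_orig :
    (augmentedLaw P).map orig = P.map fun v ↦ stack v.1 v.2.1 v.2.2 := by
  conv_rhs => rw [← augmentedLaw_map_forget P]
  rw [Measure.map_map continuous_stack.measurable (by fun_prop)]
  rfl

end Law

/-! ### The Gaussian weight and its Fourier transform -/

section Gaussian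

lemma gaussianDensity_pos {σ : ℝ} (hσ : 0 < σ) (s : Joint dx dy dz) :
    0 < gaussianDensity σ s := by
  unfold gaussianDensity
  positivity

lemma continuous_gaussianDensity (σ : ℝ) :
    Continuous (gaussianDensity σ : Joint dx dy dz → ℝ) := by
  unfold gaussianDensity
  fun_prop

lemma integrable_gaussianDensity {σ : ℝ} (hσ : 0 < σ) :
    Integrable (gaussianDensity σ : Joint dx dy dz → ℝ) := by
  have h := (GaussianFourier.integrable_cexp_neg_mul_sq_norm_add (V := Joint dx dy dz)
    (b := ((1 / (2 * σ ^ 2) : ℝ) : ℂ)) (by rw [Complex.ofReal_re]; positivity) 0 0).re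
  refine (h.const_mul ((2 * Real.pi * σ ^ 2) ^ (-((dx + dy + dz : ℕ) : ℝ) / 2))).congr
    (ae_of_all _ fun s ↦ ?_)
  simp only [gaussianDensity]
  congr 1
  rw [show -((1 / (2 * σ ^ 2) : ℝ) : ℂ) * (‖s‖ : ℂ) ^ 2 + 0 * ((inner ℝ (0 : Joint dx dy dz) s : ℝ) : ℂ) =
    ((-‖s‖ ^ 2 / (2 * σ ^ 2) : ℝ) : ℂ) by push_cast; ring]
  rw [← Complex.ofReal_exp]
  exact Complex.ofReal_re _

/-- The Gaussian kernel is the characteristic function of the Gaussian density. -/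
lemma integral_cexp_mul_gaussianDensity {σ : ℝ} (hσ : 0 < σ) (v w : Joint dx dy dz) :
    ∫ s, Complex.exp (((inner ℝ (v - w) s : ℝ) : ℂ) * Complex.I) * (gaussianDensity σ s : ℂ) =
      (gaussKernel σ v w : ℂ) := by
  have hσ' : (σ : ℂ) ≠ 0 := by exact_mod_cast hσ.ne'
  -- With `b = 1/(2σ²)` and linear coefficient `i`, the Gaussian integral is `(π/b)^(d/2) exp(i²‖v -
  -- w‖²/(4b))`: the prefactor cancels the normalisation and the exponent is `-σ²‖v - w‖²/2`.
  have h := GaussianFourier.integral_cexp_neg_mul_sq_norm_add (V := Joint dx dy dz)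
    (b := ((1 / (2 * σ ^ 2) : ℝ) : ℂ)) (by rw [Complex.ofReal_re]; positivity) Complex.I (v - w)
  have hfin : Module.finrank ℝ (Joint dx dy dz) = dx + dy + dz := by
    simp [add_assoc]
  have hpi : 0 < 2 * Real.pi * σ ^ 2 := by positivity
  set c : ℝ := (2 * Real.pi * σ ^ 2) ^ (-((dx + dy + dz : ℕ) : ℝ) / 2) with hc
  have hbase : (Real.pi : ℂ) / ((1 / (2 * σ ^ 2) : ℝ) : ℂ) = ((2 * Real.pi * σ ^ 2 : ℝ) : ℂ) := by
    push_cast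
    field_simp
  have hpow : ((2 * Real.pi * σ ^ 2 : ℝ) : ℂ) ^ ((Module.finrank ℝ (Joint dx dy dz) : ℂ) / 2) =
      ((c⁻¹ : ℝ) : ℂ) := by
    rw [hfin, hc, ← Real.rpow_neg hpi.le, Complex.ofReal_cpow hpi.le]
    congr 1
    push_cast
    ring
  rw [hbase, hpow] at h
  have hcpos : (c : ℂ) ≠ 0 := by
    have : 0 < c := by positivity
    exact_mod_cast this.ne'
  calc _ = ∫ s, (c : ℂ) * Complex.exp (-((1 / (2 * σ ^ 2) : ℝ) : ℂ) * (‖s‖ : ℂ) ^ 2 +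
        Complex.I * ((inner ℝ (v - w) s : ℝ) : ℂ)) := by
        refine integral_congr_ae (ae_of_all _ fun s ↦ ?_)
        simp only [gaussianDensity]
        rw [← hc, Complex.exp_add]
        push_cast
        rw [mul_comm Complex.I]
        have : -(1 / (2 * (σ : ℂ) ^ 2)) * (‖s‖ : ℂ) ^ 2 = -(‖s‖ : ℂ) ^ 2 / (2 * (σ : ℂ) ^ 2) := by ring
        rw [this]
        ring
    _ = _ := by
        rw [integral_const_mul, h, gaussKernel]
        push_cast
        rw [← mul_assoc, mul_inv_cancel₀ hcpos, one_mul]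
        congr 1
        rw [Complex.I_sq]
        field_simp
        ring

end Gaussian

/-! ### Spectral representation of the core function -/

section Spectral

/-- The difference of the characters at `s` evaluated at `V` and `V'`. -/
noncomputable def charDiff (s : Joint dx dy dz) (w : E dx × E dx × E dy × E dz) : ℂ :=
  Complex.exp (((inner ℝ (orig w) s : ℝ) : ℂ) * Complex.I) -
    Complex.exp (((inner ℝ (variant w) s : ℝ) : ℂ) * Complex.I)

lemma continuous_charDiff :
    Continuous fun p : Joint dx dy dz × (E dx × E dx × E dy × E dz) ↦ charDiff p.1 p.2 := by
  have h1 := continuous_orig (dx := dx) (dy := dy) (dz := dz)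
  have h2 := continuous_variant (dx := dx) (dy := dy) (dz := dz)
  unfold charDiff
  fun_prop

lemma norm_charDiff_le (s : Joint dx dy dz) (w : E dx × E dx × E dy × E dz) :
    ‖charDiff s w‖ ≤ 2 := by
  refine (norm_sub_le _ _).trans ?_
  simp only [Complex.norm_exp_ofReal_mul_I]
  norm_num

lemma star_cexp_inner (v s : Joint dx dy dz) :
    starRingEnd ℂ (Complex.exp (((inner ℝ v s : ℝ) : ℂ) * Complex.I)) =
      Complex.exp (-(((inner ℝ v s : ℝ) : ℂ) * Complex.I)) := by
  rw [← Complex.exp_conj]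
  simp

lemma integrable_cexp_mul_gaussianDensity {σ : ℝ} (hσ : 0 < σ) (v : Joint dx dy dz) :
    Integrable fun s : Joint dx dy dz ↦
      Complex.exp (((inner ℝ v s : ℝ) : ℂ) * Complex.I) * (gaussianDensity σ s : ℂ) :=
  (integrable_gaussianDensity hσ).ofReal.bdd_mul (c := 1)
    (by fun_prop) (ae_of_all _ fun s ↦ by simp [Complex.norm_exp_ofReal_mul_I])

/-- The product expands into four characters evaluated at differences of points, and each integrates
to a kernel value. This factored form turns the expectation of `core` into a squared modulus. -/
lemma integral_charDiff_mul {σ : ℝ} (hσ : 0 < σ) (w₁ w₂ : E dx × E dx × E dy × E dz) :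
    ∫ s, charDiff s w₁ * starRingEnd ℂ (charDiff s w₂) * (gaussianDensity σ s : ℂ) =
      (core σ w₁ w₂ : ℂ) := by
  have hI v := integrable_cexp_mul_gaussianDensity hσ (dx := dx) (dy := dy) (dz := dz) v
  have key (s : Joint dx dy dz) :
      charDiff s w₁ * starRingEnd ℂ (charDiff s w₂) * (gaussianDensity σ s : ℂ) =
      Complex.exp (((inner ℝ (orig w₁ - orig w₂) s : ℝ) : ℂ) * Complex.I) * (gaussianDensity σ s : ℂ)
      + Complex.exp (((inner ℝ (variant w₁ - variant w₂) s : ℝ) : ℂ) * Complex.I) *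
        (gaussianDensity σ s : ℂ)
      - Complex.exp (((inner ℝ (orig w₁ - variant w₂) s : ℝ) : ℂ) * Complex.I) *
        (gaussianDensity σ s : ℂ)
      - Complex.exp (((inner ℝ (variant w₁ - orig w₂) s : ℝ) : ℂ) * Complex.I) *
        (gaussianDensity σ s : ℂ) := by
    simp only [charDiff, map_sub, star_cexp_inner, inner_sub_left, Complex.ofReal_sub, sub_mul,
      sub_eq_add_neg (_ * Complex.I), Complex.exp_add]
    ring
  have hadd := (hI (orig w₁ - orig w₂)).add (hI (variant w₁ - variant w₂))
  have hsub := hadd.sub (hI (orig w₁ - variant w₂))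
  simp_rw [key]
  refine (integral_sub hsub (hI _)).trans ?_
  refine (congrArg (· - _) ((integral_sub hadd (hI _)).trans
    (congrArg (· - _) (integral_add (hI _) (hI _))))).trans ?_
  simp only [integral_cexp_mul_gaussianDensity hσ, core]
  push_cast
  ring

variable (P : Measure (E dx × E dy × E dz)) [IsProbabilityMeasure P]

lemma integral_charDiff (s : Joint dx dy dz) :
    ∫ w, charDiff s w ∂(augmentedLaw P) = phi₁ P s - phi₂ P s := by
  have hi {f : E dx × E dx × E dy × E dz → Joint dx dy dz} (hf : Continuous f) :
      Integrable (fun w ↦ Complex.exp (((inner ℝ (f w) s : ℝ) : ℂ) * Complex.I)) (augmentedLaw P) :=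
    Integrable.of_bound (by fun_prop) 1 (ae_of_all _ fun w ↦ by
      simp [Complex.norm_exp_ofReal_mul_I])
  simp only [charDiff]
  rw [integral_sub (hi continuous_orig) (hi continuous_variant), phi₁, phi₂,
    ← augmentedLaw_map_orig, charFun_apply, charFun_apply,
    integral_map continuous_orig.aemeasurable (by fun_prop),
    integral_map continuous_variant.aemeasurable (by fun_prop)]

/-- The core function is an unbiased estimator of `ζ_σ(P)`. -/
lemma integral_integral_core {σ : ℝ} (hσ : 0 < σ) :
    ∫ w, ∫ w', core σ w w' ∂(augmentedLaw P) ∂(augmentedLaw P) = zeta σ P := by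
  set ν := augmentedLaw P
  have hmeas : Measurable fun p : ((E dx × E dx × E dy × E dz) × (E dx × E dx × E dy × E dz)) ×
      Joint dx dy dz ↦ charDiff p.2 p.1.1 * starRingEnd ℂ (charDiff p.2 p.1.2) := by
    have h := (continuous_charDiff (dx := dx) (dy := dy) (dz := dz)).measurable
    refine (h.comp (f := fun p : ((E dx × E dx × E dy × E dz) × (E dx × E dx × E dy × E dz)) ×
      Joint dx dy dz ↦ (p.2, p.1.1)) (by fun_prop)).mul
      (Complex.continuous_conj.measurable.comp (h.comp
      (f := fun p : ((E dx × E dx × E dy × E dz) × (E dx × E dx × E dy × E dz)) ×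
      Joint dx dy dz ↦ (p.2, p.1.2)) (by fun_prop)))
  have hW : Integrable (fun p : ((E dx × E dx × E dy × E dz) × (E dx × E dx × E dy × E dz)) ×
      Joint dx dy dz ↦ (gaussianDensity σ p.2 : ℂ)) ((ν.prod ν).prod volume) :=
    Integrable.comp_snd (f := fun s : Joint dx dy dz ↦ (gaussianDensity σ s : ℂ))
      (integrable_gaussianDensity hσ).ofReal (ν.prod ν)
  have hint : Integrable (fun p : ((E dx × E dx × E dy × E dz) × (E dx × E dx × E dy × E dz)) ×
      Joint dx dy dz ↦ charDiff p.2 p.1.1 * starRingEnd ℂ (charDiff p.2 p.1.2) *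
        (gaussianDensity σ p.2 : ℂ)) ((ν.prod ν).prod volume) := by
    refine hW.bdd_mul (c := 2 * 2) hmeas.aestronglyMeasurable (ae_of_all _ fun p ↦ ?_)
    rw [norm_mul, RCLike.norm_conj]
    exact mul_le_mul (norm_charDiff_le _ _) (norm_charDiff_le _ _) (norm_nonneg _) (by norm_num)
  have hcore : Integrable (Function.uncurry (core σ)) (ν.prod ν) :=
    Integrable.of_bound (measurable_core σ).aestronglyMeasurable 2
      (ae_of_all _ fun p ↦ abs_core_le _ _ _)
  have hC : ((∫ w, ∫ w', core σ w w' ∂ν ∂ν : ℝ) : ℂ) = (zeta σ P : ℂ) := by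
    calc ((∫ w, ∫ w', core σ w w' ∂ν ∂ν : ℝ) : ℂ)
        = ((∫ p, core σ p.1 p.2 ∂(ν.prod ν) : ℝ) : ℂ) := by
          rw [integral_prod (fun p ↦ core σ p.1 p.2) hcore]
      _ = ∫ p : (E dx × E dx × E dy × E dz) × (E dx × E dx × E dy × E dz),
            (∫ s, charDiff s p.1 * starRingEnd ℂ (charDiff s p.2) * (gaussianDensity σ s : ℂ))
            ∂(ν.prod ν) := by
          rw [← integral_complex_ofReal]
          simp_rw [integral_charDiff_mul hσ]
      -- For fixed `s` the integrand is a product of functions of two independent copies, so its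
      -- expectation is the mean of `charDiff s` times its conjugate.
      _ = ∫ s : Joint dx dy dz, ∫ p : (E dx × E dx × E dy × E dz) × (E dx × E dx × E dy × E dz),
            charDiff s p.1 * starRingEnd ℂ (charDiff s p.2) * (gaussianDensity σ s : ℂ)
            ∂(ν.prod ν) := integral_integral_swap hint
      _ = ∫ s, ((‖phi₁ P s - phi₂ P s‖ ^ 2 * gaussianDensity σ s : ℝ) : ℂ) := by
          congr 1 with s
          rw [integral_mul_const, integral_prod_mul (fun w ↦ charDiff s w)
            (fun w ↦ starRingEnd ℂ (charDiff s w)), integral_conj, integral_charDiff,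
            Complex.mul_conj']
          push_cast
          rfl
      _ = (zeta σ P : ℂ) := by
          rw [integral_complex_ofReal]
          rfl
  exact_mod_cast hC

end Spectral

end CIVariant

/-! ### Nondegeneracy of the first-order projection -/

namespace CIVariant

variable {dx dy dz : ℕ}

section Support

/-- If `(Z, X)` has law `ρ ⊗ₘ κ` then almost surely `X` belongs to the support of `κ Z`. -/
lemma ae_mem_support_compProd {α β : Type*} [MeasurableSpace α] [TopologicalSpace β]
    [SecondCountableTopology β] [MeasurableSpace β] [OpensMeasurableSpace β]
    (ρ : Measure α) [SFinite ρ] (κ : Kernel α β) [IsSFiniteKernel κ] :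
    ∀ᵐ p ∂(ρ ⊗ₘ κ), p.2 ∈ (κ p.1).support := by
  set B := TopologicalSpace.countableBasis β
  -- A point outside the support lies in a null basic open set. Countability of the basis lets the
  -- exceptional null sets be handled one basic set at a time.
  have hB : ∀ᵐ p ∂(ρ ⊗ₘ κ), ∀ U ∈ B, p.2 ∈ U → κ p.1 U ≠ 0 := by
    rw [ae_ball_iff (TopologicalSpace.countable_countableBasis β)]
    intro U hU
    have hUm : MeasurableSet U :=
      ((TopologicalSpace.isBasis_countableBasis β).isOpen hU).measurableSet
    have hm : MeasurableSet {p : α × β | p.2 ∈ U → κ p.1 U ≠ 0} := by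
      have h1 : MeasurableSet {p : α × β | p.2 ∈ U} := measurable_snd hUm
      have h2 : MeasurableSet {p : α × β | κ p.1 U ≠ 0} :=
        ((κ.measurable_coe hUm).comp measurable_fst) (measurableSet_singleton 0).compl
      exact h1.imp h2
    rw [Measure.ae_compProd_iff hm]
    refine ae_of_all _ fun a ↦ ?_
    by_cases ha : κ a U = 0
    · filter_upwards [measure_eq_zero_iff_ae_notMem.1 ha] with b hb hbU using absurd hbU hb
    · exact ae_of_all _ fun b _ ↦ ha
  filter_upwards [hB] with p hp
  rw [((TopologicalSpace.isBasis_countableBasis β).nhds_hasBasis (a := p.2)).mem_measureSupport]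
  exact fun U hU ↦ pos_iff_ne_zero.2 (hp U hU.1 hU.2)

end Support

variable (P : Measure (E dx × E dy × E dz)) [IsProbabilityMeasure P]

/-- Almost surely `X` lies in the support of the conditional law of `X` given `Z`. -/
lemma ae_mem_support_condLawXZ : ∀ᵐ v ∂P, v.1 ∈ (condLawXZ P v.2.2).support := by
  have h := ae_mem_support_compProd (P.map fun v ↦ v.2.2) (condLawXZ P)
  rw [condLawXZ, compProd_map_condDistrib (by fun_prop)] at h
  exact ae_of_ae_map (by fun_prop) h

/-- Disintegration of the augmented law: `(X, Y, Z)` is frozen while `X'` still varies, which allows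
a topological argument in `x'` alone. -/
lemma ae_ae_of_ae_augmentedLaw {p : E dx × E dx × E dy × E dz → Prop}
    (hp : ∀ᵐ w ∂(augmentedLaw P), p w) :
    ∀ᵐ v ∂P, ∀ᵐ x' ∂(condLawXZ P v.2.2), p (v.1, x', v.2.1, v.2.2) := by
  have h := ae_of_ae_map (by fun_prop) hp
  filter_upwards [Measure.ae_ae_of_ae_compProd h] with v hv
  exact hv

/-- The witness function `h(v) = E[K(v, V) - K(v, V')]`. -/
noncomputable def witness (σ : ℝ) (v : Joint dx dy dz) : ℝ :=
  ∫ w, (gaussKernel σ v (orig w) - gaussKernel σ v (variant w)) ∂(augmentedLaw P)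

lemma continuous_gaussKernel_comp (σ : ℝ) {α : Type*} [TopologicalSpace α]
    {f g : α → Joint dx dy dz} (hf : Continuous f) (hg : Continuous g) :
    Continuous fun a ↦ gaussKernel σ (f a) (g a) := by
  unfold gaussKernel
  fun_prop

lemma abs_gaussKernel_sub_le (σ : ℝ) (v w w' : Joint dx dy dz) :
    |gaussKernel σ v w - gaussKernel σ v w'| ≤ 1 := by
  rw [abs_le]
  constructor <;> linarith [gaussKernel_pos σ v w, gaussKernel_pos σ v w',
    gaussKernel_le_one σ v w, gaussKernel_le_one σ v w']

lemma measurable_gaussKernel_sub (σ : ℝ) (v : Joint dx dy dz) :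
    Measurable fun w : E dx × E dx × E dy × E dz ↦
      gaussKernel σ v (orig w) - gaussKernel σ v (variant w) :=
  ((continuous_gaussKernel_comp σ continuous_const continuous_orig).sub
    (continuous_gaussKernel_comp σ continuous_const continuous_variant)).measurable

/-- By dominated convergence. Continuity is what extends an identity valid for almost every `x'` to
every point of the support. -/
lemma continuous_witness (σ : ℝ) : Continuous (witness P σ) := by
  refine continuous_of_dominated (bound := fun _ ↦ 1)
    (fun v ↦ (measurable_gaussKernel_sub σ v).aestronglyMeasurable)
    (fun v ↦ ae_of_all _ fun w ↦ abs_gaussKernel_sub_le _ _ _ _) (by simp)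
    (ae_of_all _ fun w ↦ ?_)
  exact (continuous_gaussKernel_comp σ continuous_id continuous_const).sub
    (continuous_gaussKernel_comp σ continuous_id continuous_const)

/-- As an increment of a single function between `V` and `V'`, the projection vanishes when `x' =
x`. -/
lemma proj₁_eq (σ : ℝ) (w : E dx × E dx × E dy × E dz) :
    proj₁ σ P w = witness P σ (orig w) - witness P σ (variant w) := by
  have hi v : Integrable (fun w ↦ gaussKernel σ v (orig w) - gaussKernel σ v (variant w))
      (augmentedLaw P) :=
    Integrable.of_bound (measurable_gaussKernel_sub σ v).aestronglyMeasurable 1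
      (ae_of_all _ fun w ↦ abs_gaussKernel_sub_le _ _ _ _)
  rw [witness, witness, ← integral_sub (hi _) (hi _), proj₁]
  refine integral_congr_ae (ae_of_all _ fun w' ↦ ?_)
  simp only [core]
  ring

/-- The first-order projection is not almost surely equal to a nonzero constant. -/
lemma eq_zero_of_proj₁_ae_eq_const (σ : ℝ) {c : ℝ}
    (h : ∀ᵐ w ∂(augmentedLaw P), proj₁ σ P w = c) : c = 0 := by
  obtain ⟨v, hv, hsupp⟩ := ((ae_ae_of_ae_augmentedLaw P h).and (ae_mem_support_condLawXZ P)).exists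
  have hclosed : IsClosed {x' : E dx | proj₁ σ P (v.1, x', v.2.1, v.2.2) = c} := by
    simp_rw [proj₁_eq]
    have h1 : Continuous fun x' : E dx ↦ variant (x', x', v.2.1, v.2.2) :=
      continuous_variant.comp (f := fun x' : E dx ↦ (x', x', v.2.1, v.2.2)) (by fun_prop)
    have h2 := (continuous_witness P σ).comp h1
    exact isClosed_eq (Continuous.sub (f := fun _ : E dx ↦ witness P σ (stack v.1 v.2.1 v.2.2))
      continuous_const h2) continuous_const
  -- A closed set of full measure contains the support, hence the point `v.1`; there the two vectors
  -- coincide and the increment is zero.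
  have hmem := Measure.support_subset_of_isClosed hclosed hv hsupp
  rw [Set.mem_ofPred_eq, proj₁_eq] at hmem
  rw [← hmem]
  exact sub_self _

lemma measurable_proj₁ (σ : ℝ) : Measurable (proj₁ σ P) :=
  UStatistic.measurable_proj (measurable_core σ)

lemma abs_proj₁_le (σ : ℝ) (w : E dx × E dx × E dy × E dz) : |proj₁ σ P w| ≤ 2 :=
  UStatistic.abs_integral_le _ (abs_core_le σ w)

/-- Zero variance would make the projection almost surely equal to its mean, which is `ζ_σ(P)`,
while zero is the only constant it can equal. -/
lemma sigmaOneSq_pos {σ : ℝ} (hσ : 0 < σ) (hζ : zeta σ P ≠ 0) : 0 < sigmaOneSq σ P := by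
  refine lt_of_le_of_ne (variance_nonneg _ _) fun h0 ↦ hζ ?_
  have hmem : MemLp (proj₁ σ P) 2 (augmentedLaw P) :=
    MemLp.of_bound (measurable_proj₁ P σ).aestronglyMeasurable 2
      (ae_of_all _ fun w ↦ abs_proj₁_le P σ w)
  have h := ae_eq_integral_of_variance_eq_zero hmem h0.symm
  rw [show ∫ w, proj₁ σ P w ∂(augmentedLaw P) = zeta σ P from integral_integral_core P hσ] at h
  exact eq_zero_of_proj₁_ae_eq_const P σ h

/-! ### Vanishing of `ζ_σ(P)` forces conditional independence -/

section Null

lemma continuous_phi_sub : Continuous fun s : Joint dx dy dz ↦ phi₁ P s - phi₂ P s := by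
  have := Measure.isProbabilityMeasure_map (μ := P)
    (continuous_stack (dx := dx) (dy := dy) (dz := dz)).aemeasurable
  have := Measure.isProbabilityMeasure_map (μ := augmentedLaw P)
    (continuous_variant (dx := dx) (dy := dy) (dz := dz)).aemeasurable
  unfold phi₁ phi₂
  exact continuous_charFun.sub continuous_charFun

/-- A continuous nonnegative integrand with zero integral vanishes everywhere, since Lebesgue
measure charges every nonempty open set; the weight is strictly positive and can be divided out. -/
lemma phi_eq_of_zeta_eq_zero {σ : ℝ} (hσ : 0 < σ) (hζ : zeta σ P = 0) : phi₁ P = phi₂ P := by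
  have hcont : Continuous fun s : Joint dx dy dz ↦
      ‖phi₁ P s - phi₂ P s‖ ^ 2 * gaussianDensity σ s :=
    ((continuous_phi_sub P).norm.pow 2).mul (continuous_gaussianDensity σ)
  have hle s : ‖phi₁ P s - phi₂ P s‖ ≤ 2 := by
    rw [← integral_charDiff]
    simpa using norm_integral_le_of_norm_le_const (μ := augmentedLaw P)
      (ae_of_all _ fun w ↦ norm_charDiff_le s w)
  have hint : Integrable fun s : Joint dx dy dz ↦
      ‖phi₁ P s - phi₂ P s‖ ^ 2 * gaussianDensity σ s := by
    refine (integrable_gaussianDensity hσ).bdd_mul (c := 2 ^ 2)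
      ((continuous_phi_sub P).norm.pow 2).aestronglyMeasurable (ae_of_all _ fun s ↦ ?_)
    rw [norm_pow, norm_norm]
    gcongr
    exact hle s
  have hae := (integral_eq_zero_iff_of_nonneg
    (fun s ↦ mul_nonneg (sq_nonneg _) (gaussianDensity_pos hσ s).le) hint).1 hζ
  have hall := (hcont.ae_eq_iff_eq volume continuous_zero).1 hae
  funext s
  have hs := congrFun hall s
  simp only [Pi.zero_apply, mul_eq_zero, (gaussianDensity_pos hσ s).ne', or_false] at hs
  exact sub_eq_zero.1 (norm_eq_zero.1 (pow_eq_zero_iff two_ne_zero |>.1 hs))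

/-- Splitting a concatenated vector into its three blocks. -/
def unstack (v : Joint dx dy dz) : E dx × E dy × E dz :=
  (WithLp.toLp 2 fun i ↦ v (Sum.inl i), WithLp.toLp 2 fun i ↦ v (Sum.inr (Sum.inl i)),
    WithLp.toLp 2 fun i ↦ v (Sum.inr (Sum.inr i)))

lemma measurable_unstack : Measurable (unstack : Joint dx dy dz → E dx × E dy × E dz) := by
  unfold unstack
  fun_prop

/-- The law of `(X', Y, Z)` determines the null hypothesis. -/
lemma nullHypothesis_of_map_eq
    (h : (augmentedLaw P).map (fun w ↦ (w.2.1, w.2.2.1, w.2.2.2)) = P) : NullHypothesis P := by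
  -- Conditional independence is symmetric; with `Y` first, the criterion says that the conditional
  -- law of `X` given `(Z, Y)` depends on `Z` only.
  have hnull : CondIndepFun (MeasurableSpace.comap (fun v : E dx × E dy × E dz ↦ v.2.2) inferInstance)
      (Measurable.comap_le (by fun_prop))
      (fun v : E dx × E dy × E dz ↦ v.2.1) (fun v : E dx × E dy × E dz ↦ v.1) P := by
    refine (condIndepFun_iff_condDistrib_prod_ae_eq_prodMkRight (by fun_prop) (by fun_prop)
      (by fun_prop)).2 ?_
    refine condDistrib_ae_eq_of_measure_eq_compProd _ (by fun_prop) ?_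
    -- By `h`, `X` may be replaced by `X'`, whose conditional law given `(Z, Y)` is `condLawXZ P` at
    -- `Z` by construction.
    have h1 : P.map (fun v ↦ ((v.2.2, v.2.1), v.1)) =
        (P ⊗ₘ ((condLawXZ P).comap (fun v : E dx × E dy × E dz ↦ v.2.2) (by fun_prop))).map
          (fun p ↦ ((p.1.2.2, p.1.2.1), p.2)) := by
      conv_lhs => rw [← h]
      rw [augmentedLaw, Measure.map_map (by fun_prop) (by fun_prop),
        Measure.map_map (by fun_prop) (by fun_prop)]
      rfl
    rw [h1]
    ext s hs
    rw [Measure.map_apply (by fun_prop) hs, Measure.compProd_apply (by measurability),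
      Measure.compProd_apply hs, lintegral_map (Kernel.measurable_kernel_prodMk_left hs)
        (by fun_prop)]
    rfl
  exact hnull.symm

lemma zeta_ne_zero {σ : ℝ} (hσ : 0 < σ) (hH₁ : ¬ NullHypothesis P) : zeta σ P ≠ 0 := by
  refine fun hζ ↦ hH₁ (nullHypothesis_of_map_eq P ?_)
  have := Measure.isProbabilityMeasure_map (μ := P)
    (continuous_stack (dx := dx) (dy := dy) (dz := dz)).aemeasurable
  have := Measure.isProbabilityMeasure_map (μ := augmentedLaw P)
    (continuous_variant (dx := dx) (dy := dy) (dz := dz)).aemeasurable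
  have hlaw : P.map (fun v ↦ stack v.1 v.2.1 v.2.2) = (augmentedLaw P).map variant :=
    Measure.ext_of_charFun (phi_eq_of_zeta_eq_zero P hσ hζ)
  -- `unstack` is a left inverse of `stack`, so equality of laws descends from the joint Euclidean
  -- space to the product.
  have := congrArg (Measure.map unstack) hlaw
  rw [Measure.map_map measurable_unstack continuous_stack.measurable,
    Measure.map_map measurable_unstack continuous_variant.measurable] at this
  exact this.symm.trans Measure.map_id

end Null

end CIVariant

theorem theorem2p5 {dx dy dz : ℕ} (σ : ℝ) (hσ : 0 < σ)
    (P : Measure (CIVariant.E dx × CIVariant.E dy × CIVariant.E dz)) [IsProbabilityMeasure P]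
    {Ω : Type*} [MeasurableSpace Ω] (μ : Measure Ω) [IsProbabilityMeasure μ]
    (X X' : ℕ → Ω → CIVariant.E dx) (Y : ℕ → Ω → CIVariant.E dy) (Z : ℕ → Ω → CIVariant.E dz)
    (hindep : iIndepFun (fun i ω ↦ (X i ω, X' i ω, Y i ω, Z i ω)) μ)
    (hlaw : ∀ i, HasLaw (fun ω ↦ (X i ω, X' i ω, Y i ω, Z i ω)) (CIVariant.augmentedLaw P) μ)
    (hH₁ : ¬ CIVariant.NullHypothesis P) :
    0 < CIVariant.sigmaOneSq σ P ∧
    TendstoInDistribution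
      (fun (n : ℕ) ω ↦ √(n : ℝ) *
        (CIVariant.zetaHat σ n (fun i ↦ (X i ω, X' i ω, Y i ω, Z i ω)) - CIVariant.zeta σ P))
      atTop (id : ℝ → ℝ) (fun _ ↦ μ)
      (gaussianReal 0 (4 * CIVariant.sigmaOneSq σ P).toNNReal) := by
  refine ⟨CIVariant.sigmaOneSq_pos P hσ (CIVariant.zeta_ne_zero P hσ hH₁), ?_⟩
  rw [← CIVariant.integral_integral_core P hσ]
  exact UStatistic.tendstoInDistribution_stat hindep hlaw (CIVariant.measurable_core σ)
    (CIVariant.abs_core_le σ) (CIVariant.core_comm σ)
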